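/- Let $R$ be an associative unital ring. Let $P(R)$ be the category of all projective left $R$-modules, and let $P_f(R)$ be the category of finitely generated projective left $R$-modules, regarded as an exact category in which the exact sequences are the split short exact sequences. For an additive category $\mathcal{C}$ with its split exact structure, let $\mathsf{Lex}(\mathcal{C})$ be the category of functors $F\colon \mathcal{C}^{op}\to\mathsf{Ab}$ such that $0\to F(Z)\to F(Y)\to F(X)$ is exact for every exact sequence $X\hookrightarrow Y\twoheadrightarrow Z$ in $\mathcal{C}$. Let $\mathsf{Ind}^a(\mathcal{C})$ be the full subcategory of $\mathsf{Lex}(\mathcal{C})$ consisting of the presheaves isomorphic to $Y\mapsto \operatorname{colim}_{i\in I}\hom_{\mathcal{C}}(Y,X_i)$ for some functor $X\colon I\to\mathcal{C}$, where $I$ is a nonempty directed poset and $X$ sends every arrow of $I$ to an admissible monic (the kernel in an exact sequence of $\mathcal{C}$). Finally, let $P(\mathcal{C})$ be the full subcategory of the idempotent completion $\mathsf{Ind}^a(\mathcal{C})^{ic}$ whose objects are the direct summands of arbitrary (set-indexed) direct sums of objects of $\mathcal{C}$, where $\mathcal{C}$ is embedded by $X\mapsto\hom_{\mathcal{C}}(-,X)$.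 Then the categories $P(R)$ and $P(P_f(R))$ are equivalent. -/

import Mathlib

open CategoryTheory CategoryTheory.Limits

universe v u

/-- An exact structure (in the sense of Quillen) on an additive category `C`: a class of
kernel-cokernel pairs, closed under isomorphism, such that identities are admissible monics and
admissible epics, both classes are closed under composition, admissible monics are stable under
pushout and admissible epics are stable under pullback. -/
structure ExactStructure (C : Type u) [Category.{v} C] [Preadditive C]
    [HasFiniteBiproducts C] where
  /-- the exact sequences -/
  IsExact : ObjectProperty (ShortComplex C)
  of_iso : ∀ {S T : ShortComplex C}, (S ≅ T) → IsExact S → IsExact T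
  isKernel : ∀ S : ShortComplex C, IsExact S → Nonempty (IsLimit (KernelFork.ofι S.f S.zero))
  isCokernel : ∀ S : ShortComplex C, IsExact S →
    Nonempty (IsColimit (CokernelCofork.ofπ S.g S.zero))
  mono_id : ∀ X : C, ∃ (Z : C) (g : X ⟶ Z) (w : 𝟙 X ≫ g = 0), IsExact (.mk (𝟙 X) g w)
  epi_id : ∀ Z : C, ∃ (X : C) (f : X ⟶ Z) (w : f ≫ 𝟙 Z = 0), IsExact (.mk f (𝟙 Z) w)
  mono_comp : ∀ {X Y W : C} (f : X ⟶ Y) (f' : Y ⟶ W),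
    (∃ (Z : C) (g : Y ⟶ Z) (w : f ≫ g = 0), IsExact (.mk f g w)) →
    (∃ (Z : C) (g : W ⟶ Z) (w : f' ≫ g = 0), IsExact (.mk f' g w)) →
    ∃ (Z : C) (g : W ⟶ Z) (w : (f ≫ f') ≫ g = 0), IsExact (.mk (f ≫ f') g w)
  epi_comp : ∀ {Y Z V : C} (g : Y ⟶ Z) (g' : Z ⟶ V),
    (∃ (X : C) (f : X ⟶ Y) (w : f ≫ g = 0), IsExact (.mk f g w)) →
    (∃ (X : C) (f : X ⟶ Z) (w : f ≫ g' = 0), IsExact (.mk f g' w)) →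
    ∃ (X : C) (f : X ⟶ Y) (w : f ≫ g ≫ g' = 0), IsExact (.mk f (g ≫ g') w)
  mono_pushout : ∀ {X Y X' : C} (f : X ⟶ Y) (a : X ⟶ X'),
    (∃ (Z : C) (g : Y ⟶ Z) (w : f ≫ g = 0), IsExact (.mk f g w)) →
    ∃ (Y' : C) (a' : Y ⟶ Y') (f' : X' ⟶ Y'), IsPushout f a a' f' ∧
      ∃ (Z : C) (g : Y' ⟶ Z) (w : f' ≫ g = 0), IsExact (.mk f' g w)
  epi_pullback : ∀ {Y Z Z' : C} (g : Y ⟶ Z) (b : Z' ⟶ Z),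
    (∃ (X : C) (f : X ⟶ Y) (w : f ≫ g = 0), IsExact (.mk f g w)) →
    ∃ (Y' : C) (b' : Y' ⟶ Y) (g' : Y' ⟶ Z'), IsPullback b' g' g b ∧
      ∃ (X : C) (f : X ⟶ Y') (w : f ≫ g' = 0), IsExact (.mk f g' w)

namespace ExactStructure

section Split

variable (C : Type u) [Category.{v} C] [Preadditive C] [HasFiniteBiproducts C]

/-- The split exact structure on an additive category: the exact sequences are the split ones. -/
def split : ExactStructure C where
  IsExact S := Nonempty S.Splitting
  of_iso e := fun ⟨s⟩ => ⟨s.ofIso e⟩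
  isKernel _ := fun ⟨s⟩ => ⟨s.fIsKernel⟩
  isCokernel _ := fun ⟨s⟩ => ⟨s.gIsCokernel⟩
  mono_id X := by
    have := hasZeroObject_of_hasFiniteBiproducts C
    open ZeroObject in
    exact ⟨0, 0, by simp, ⟨{ r := 𝟙 X, s := 0, s_g := by simp }⟩⟩
  epi_id Z := by
    have := hasZeroObject_of_hasFiniteBiproducts C
    open ZeroObject in
    exact ⟨0, 0, by simp, ⟨{ r := 0, s := 𝟙 Z, f_r := by simp }⟩⟩
  mono_comp := by
    have := hasBinaryBiproducts_of_finite_biproducts C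
    rintro X Y W f f' ⟨Z, g, w, ⟨s⟩⟩ ⟨V, g', w', ⟨s'⟩⟩
    have h1 := s.f_r; have h2 := s.s_g; have h3 := s.id; have h4 := s.s_r
    have h1' := s'.f_r; have h2' := s'.s_g; have h3' := s'.id; have h4' := s'.s_r
    dsimp at h1 h2 h3 h4 h1' h2' h3' h4'
    refine ⟨Z ⊞ V, biprod.lift (s'.r ≫ g) g', ?_, ⟨?_⟩⟩
    · ext <;> simp [reassoc_of% h1', w, w']
    · refine
        { r := s'.r ≫ s.r
          s := biprod.desc (s.s ≫ f') s'.s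
          f_r := by simp [reassoc_of% h1', h1]
          s_g := by ext <;> simp [reassoc_of% h1', h2, w', reassoc_of% h4', h2']
          id := ?_ }
      have : s'.r ≫ (s.r ≫ f + g ≫ s.s) ≫ f' + g' ≫ s'.s = 𝟙 _ := by rw [h3]; simpa using h3'
      simpa [add_assoc] using this
  epi_comp := by
    have := hasBinaryBiproducts_of_finite_biproducts C
    rintro Y Z V g g' ⟨X, f, w, ⟨s⟩⟩ ⟨U, f', w', ⟨s'⟩⟩
    have h1 := s.f_r; have h2 := s.s_g; have h3 := s.id; have h4 := s.s_r
    have h1' := s'.f_r; have h2' := s'.s_g; have h3' := s'.id; have h4' := s'.s_r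
    dsimp at h1 h2 h3 h4 h1' h2' h3' h4'
    refine ⟨X ⊞ U, biprod.desc f (f' ≫ s.s), ?_, ⟨?_⟩⟩
    · ext <;> simp [reassoc_of% h2, reassoc_of% w, w']
    · refine
        { r := biprod.lift s.r (g ≫ s'.r)
          s := s'.s ≫ s.s
          f_r := by ext <;> simp [h1, reassoc_of% w, h4, reassoc_of% h2, h1']
          s_g := by simp [reassoc_of% h2, h2']
          id := ?_ }
      have : s.r ≫ f + g ≫ (s'.r ≫ f' + g' ≫ s'.s) ≫ s.s = 𝟙 _ := by rw [h3']; simpa using h3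
      simpa [add_assoc] using this
  mono_pushout := by
    have := hasBinaryBiproducts_of_finite_biproducts C
    rintro X Y X' f a ⟨Z, g, w, ⟨s⟩⟩
    have h1 := s.f_r; have h2 := s.s_g; have h3 := s.id; have h4 := s.s_r
    dsimp at h1 h2 h3 h4
    refine ⟨X' ⊞ Z, biprod.lift (s.r ≫ a) g, biprod.inl, ⟨⟨?_⟩, ⟨?_⟩⟩,
      Z, biprod.snd, by simp, ⟨{ r := biprod.fst, s := biprod.inr }⟩⟩
    · ext <;> simp [reassoc_of% h1, w]
    · refine PushoutCocone.IsColimit.mk _ (fun c => biprod.desc c.inr (s.s ≫ c.inl)) ?_ ?_ ?_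
      · intro c
        have : (s.r ≫ f + g ≫ s.s) ≫ c.inl = c.inl := by rw [h3]; simp
        simpa [c.condition] using this
      · intro c; simp
      · intro c m hm1 hm2
        ext
        · simpa using hm2
        · simp [← hm1, biprod.lift_eq, reassoc_of% h4, reassoc_of% h2]
  epi_pullback := by
    have := hasBinaryBiproducts_of_finite_biproducts C
    rintro Y Z Z' g b ⟨X, f, w, ⟨s⟩⟩
    have h1 := s.f_r; have h2 := s.s_g; have h3 := s.id; have h4 := s.s_r
    dsimp at h1 h2 h3 h4
    refine ⟨X ⊞ Z', biprod.desc f (b ≫ s.s), biprod.snd, ⟨⟨?_⟩, ⟨?_⟩⟩,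
      X, biprod.inl, by simp, ⟨{ r := biprod.fst, s := biprod.inr }⟩⟩
    · ext <;> simp [h2, w]
    · refine PullbackCone.IsLimit.mk _ (fun c => biprod.lift (c.fst ≫ s.r) c.snd) ?_ ?_ ?_
      · intro c
        have : c.fst ≫ (s.r ≫ f + g ≫ s.s) = c.fst := by rw [h3]; simp
        simpa [← c.condition_assoc] using this
      · intro c; simp
      · intro c m hm1 hm2
        ext
        · simp [← hm1, biprod.desc_eq, h4, h1]
        · simpa using hm2

end Split

variable {C : Type u} [Category.{v} C] [Preadditive C] [HasFiniteBiproducts C]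
variable (E : ExactStructure C)

/-- Admissible monics: the maps that are the kernel in an exact sequence. -/
def IsAdmissibleMono {X Y : C} (f : X ⟶ Y) : Prop :=
  ∃ (Z : C) (g : Y ⟶ Z) (w : f ≫ g = 0), E.IsExact (.mk f g w)

/-- Left-exact presheaves of abelian groups: every exact sequence `X ⟶ Y ⟶ Z` is sent to an
exact sequence `0 ⟶ F(Z) ⟶ F(Y) ⟶ F(X)`. -/
def isLeftExact : ObjectProperty (Cᵒᵖ ⥤ AddCommGrpCat.{v}) := fun F =>
  ∀ S : ShortComplex C, E.IsExact S →
    Function.Injective (F.map S.g.op) ∧ Function.Exact (F.map S.g.op) (F.map S.f.op)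

/-- The category `Lex(C)` of left-exact presheaves of abelian groups. -/
abbrev Lex := E.isLeftExact.FullSubcategory

/-- Admissible Ind-diagrams: functors on a directed poset taking all arrows to admissible
monics. -/
def IsAdmissibleIndDiagram {I : Type v} [PartialOrder I] (X : I ⥤ C) : Prop :=
  Nonempty I ∧ IsDirectedOrder I ∧ ∀ ⦃i j : I⦄ (a : i ⟶ j), E.IsAdmissibleMono (X.map a)

/-- The left-exact presheaves in the essential image of the admissible Ind-diagrams, where a
diagram `X` is sent to the presheaf `Y ↦ colim_i Hom(Y, X_i)`. -/
def isAdmissibleInd : ObjectProperty E.Lex := fun F =>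
  ∃ (I : Type v) (_ : PartialOrder I) (X : I ⥤ C), E.IsAdmissibleIndDiagram X ∧
    Nonempty (F.obj ≅ colimit (X ⋙ preadditiveYoneda))

/-- The category `Ind^a(C)` of admissible Ind-objects, a full subcategory of `Lex(C)`. -/
abbrev Ind := E.isAdmissibleInd.FullSubcategory

lemma isLeftExact_yoneda (X : C) : E.isLeftExact (preadditiveYoneda.obj X) := by
  intro S hS
  obtain ⟨h⟩ := E.isCokernel S hS
  refine ⟨fun a b hab => ?_, fun a => ⟨fun ha => ?_, ?_⟩⟩
  · exact Cofork.IsColimit.hom_ext h hab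
  · obtain ⟨l, hl⟩ := CokernelCofork.IsColimit.desc' h a ha
    exact ⟨l, hl⟩
  · rintro ⟨b, rfl⟩
    exact (S.zero_assoc (show S.X₃ ⟶ X from b)).trans zero_comp

/-- The Yoneda embedding `C ⥤ Lex(C)`, `X ↦ Hom(-, X)`. -/
def toLex : C ⥤ E.Lex := E.isLeftExact.lift preadditiveYoneda E.isLeftExact_yoneda

lemma isAdmissibleInd_toLex (X : C) : E.isAdmissibleInd (E.toLex.obj X) := by
  refine ⟨PUnit, inferInstance, (Functor.const _).obj X, ⟨inferInstance, inferInstance,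
    fun _ _ _ => E.mono_id X⟩, ⟨?_⟩⟩
  let t : IsTerminal (PUnit.unit : PUnit.{v + 1}) :=
    IsTerminal.ofUniqueHom (fun _ => 𝟙 _) (fun _ _ => rfl)
  exact (colimit.isColimit _).coconePointUniqueUpToIso
    (colimitOfDiagramTerminal t ((Functor.const _).obj X ⋙ preadditiveYoneda)) |>.symm

/-- The embedding `C ⥤ Ind^a(C)`, `X ↦ Hom(-, X)`. -/
def toInd : C ⥤ E.Ind := E.isAdmissibleInd.lift E.toLex E.isAdmissibleInd_toLex

end ExactStructure

/-- An object `A` of an additive category is a direct summand of `S` if there is an object `B`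
and a direct sum decomposition of `S` with summands `A` and `B`. -/
def IsDirectSummand {D : Type u} [Category.{v} D] [Preadditive D] (A S : D) : Prop :=
  ∃ (B : D) (b : BinaryBicone A B), Nonempty b.IsBilimit ∧ Nonempty (b.pt ≅ S)

/-- The objects of `P(C)`, for an additive category `C` with its split exact structure: direct
summands, in the idempotent completion of `Ind^a(C)`, of arbitrary direct sums (coproducts) of
objects of `C`. -/
def isProjObject (C : Type u) [Category.{v} C] [Preadditive C] [HasFiniteBiproducts C] :
    ObjectProperty (Idempotents.Karoubi (ExactStructure.split C).Ind) := fun A =>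
  ∃ (J : Type v) (X : J → C)
    (c : Cofan fun j => (Idempotents.toKaroubi _).obj ((ExactStructure.split C).toInd.obj (X j))),
    Nonempty (IsColimit c) ∧ IsDirectSummand A c.pt

/-- The category `P(C)`, a full subcategory of the idempotent completion of `Ind^a(C)`. -/
abbrev ProjObject (C : Type u) [Category.{v} C] [Preadditive C] [HasFiniteBiproducts C] :=
  (isProjObject C).FullSubcategory

/-- The projective (left) `R`-modules. -/
def isProjModule (R : Type u) [Ring R] : ObjectProperty (ModuleCat.{u} R) := fun M =>
  Module.Projective R M

/-- The finitely generated projective (left) `R`-modules. -/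
def isFGProjModule (R : Type u) [Ring R] : ObjectProperty (ModuleCat.{u} R) := fun M =>
  Module.Finite R M ∧ Module.Projective R M

/-- The category `P(R)` of projective `R`-modules. -/
abbrev ProjModule (R : Type u) [Ring R] := (isProjModule R).FullSubcategory

/-- The category `P_f(R)` of finitely generated projective `R`-modules. -/
abbrev FGProjModule (R : Type u) [Ring R] := (isFGProjModule R).FullSubcategory

instance (R : Type u) [Ring R] : HasFiniteBiproducts (FGProjModule R) := by
  have : (isFGProjModule R).IsClosedUnderFiniteProducts := by
    refine ⟨fun J _ => ⟨?_⟩⟩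
    rintro M ⟨p⟩
    have h := fun j => p.prop_diag_obj ⟨j⟩
    have h1 (j : J) : Module.Finite R (p.diag.obj ⟨j⟩) := (h j).1
    have h2 (j : J) : Module.Projective R (p.diag.obj ⟨j⟩) := (h j).2
    have := Fintype.ofFinite J
    classical
    let c : Cone p.diag :=
      { pt := ModuleCat.of R (∀ j : J, p.diag.obj ⟨j⟩)
        π := Discrete.natTrans fun j => ModuleCat.ofHom (LinearMap.proj j.as) }
    let hc : IsLimit c :=
      { lift := fun s => ModuleCat.ofHom (LinearMap.pi fun j => (s.π.app ⟨j⟩).hom)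
        fac := fun s j => rfl
        uniq := fun s m hm => by
          ext x j
          exact congrArg (fun f => f.hom x) (hm ⟨j⟩) }
    let e := (p.isLimit.conePointUniqueUpToIso hc).symm.toLinearEquiv
    have hf : Module.Finite R (∀ j : J, p.diag.obj ⟨j⟩) := inferInstance
    have : Module.Projective R (Π₀ j : J, p.diag.obj ⟨j⟩) := inferInstance
    have hp : Module.Projective R (∀ j : J, p.diag.obj ⟨j⟩) :=
      Module.Projective.of_equiv DFinsupp.linearEquivFunOnFintype
    exact ⟨Module.Finite.equiv e, Module.Projective.of_equiv e⟩
  exact HasFiniteBiproducts.of_hasFiniteProducts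

/-! ### The presheaf of an `R`-module on finitely generated projective modules -/

/-! Restricting the Yoneda functor to finitely generated projectives loses nothing: a transformation
`Hom(-, M) ⟶ Hom(-, N)` is recovered from its value on `R`, since elements of `M` are maps `R ⟶ M`.
So modules embed fully faithfully in presheaves (`fullyFaithfulRestrictedYoneda`).

A map from a finitely generated module to `⨁ X j` meets only finitely many summands. Hence the
presheaf of `⨁ X j` is the coproduct of the representables of the `X j`, and also the directed
colimit of those of the finite partial sums, along split inclusions. It is therefore an admissible
Ind-object, and it is the coproduct of the `X j` in the idempotent completion as well
(`isColimitDirectSumCofan`).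

Both categories thus embed in the idempotent completion of presheaves, and it remains to compare
essential images (`essImage_toKaroubiPresheaf`). A projective module is a retract of a free one, so
it gives an idempotent on an Ind-object of this kind. Conversely, a direct summand of a coproduct of
the `X j` is cut out by an idempotent that comes from an endomorphism of the module `⨁ X j`, and
this splits among modules with projective image. -/

/-- The functor sending a module `M` to the presheaf `P ↦ Hom(P, M)` on the finitely generated
projective modules. -/
noncomputable def restrictedYoneda (R : Type u) [Ring R] :
    ModuleCat.{u} R ⥤ (FGProjModule R)ᵒᵖ ⥤ AddCommGrpCat.{u} :=
  preadditiveYoneda ⋙ (Functor.whiskeringLeft _ _ _).obj (isFGProjModule R).ι.op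

section RestrictedYoneda

variable {R : Type u} [Ring R]

/-- The module `R`, as a finitely generated projective module. -/
def FGProjModule.self (R : Type u) [Ring R] : FGProjModule R :=
  ⟨ModuleCat.of R R, inferInstanceAs (Module.Finite R R), inferInstanceAs (Module.Projective R R)⟩

/-- The morphism `R ⟶ M` with value `m` at `1`. -/
def ModuleCat.homOfElement {M : ModuleCat.{u} R} (m : M) : ModuleCat.of R R ⟶ M :=
  ModuleCat.ofHom (LinearMap.toSpanSingleton R M m)

lemma ModuleCat.homOfElement_comp {M N : ModuleCat.{u} R} (m : M) (f : M ⟶ N) :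
    homOfElement m ≫ f = homOfElement (f m) := by
  ext
  simp [homOfElement]

lemma ModuleCat.homOfElement_add {M : ModuleCat.{u} R} (m n : M) :
    homOfElement (m + n) = homOfElement m + homOfElement n := by
  ext
  simp [homOfElement]

lemma ModuleCat.homOfElement_smul {M : ModuleCat.{u} R} (r : R) (m : M) :
    homOfElement (r • m) = homOfElement (M := ModuleCat.of R R) r ≫ homOfElement m := by
  ext
  simp [homOfElement]

/-- Evaluation at `1 : R`. -/
def ModuleCat.evalOne {M : ModuleCat.{u} R} (f : ModuleCat.of R R ⟶ M) : M :=
  f.hom (1 : R)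

/-- A transformation of restricted Yoneda presheaves is natural in precomposition. -/
lemma restrictedYoneda_app_comp {M : ModuleCat.{u} R} {F : (FGProjModule R)ᵒᵖ ⥤ AddCommGrpCat.{u}}
    (α : (restrictedYoneda R).obj M ⟶ F) {P Q : FGProjModule R} (q : P.obj ⟶ Q.obj)
    (h : Q.obj ⟶ M) :
    α.app (.op P) (q ≫ h : P.obj ⟶ M) = F.map (ObjectProperty.homMk q : P ⟶ Q).op (α.app (.op Q) h) :=
  congrArg (fun φ => φ.hom h) (α.naturality (ObjectProperty.homMk q : P ⟶ Q).op)

/-- The linear map inducing a given transformation of restricted Yoneda presheaves. -/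
noncomputable def restrictedYonedaPreimage {M N : ModuleCat.{u} R}
    (α : (restrictedYoneda R).obj M ⟶ (restrictedYoneda R).obj N) : M ⟶ N :=
  ModuleCat.ofHom
    { toFun m := ModuleCat.evalOne
        (α.app (.op (FGProjModule.self R)) (ModuleCat.homOfElement m : _ ⟶ M))
      map_add' m n := by
        rw [ModuleCat.homOfElement_add]
        exact congrArg ModuleCat.evalOne
          (map_add (α.app (.op (FGProjModule.self R))).hom _ _)
      map_smul' r m := by
        rw [ModuleCat.homOfElement_smul]
        -- Right multiplication by `r` is a left-linear endomorphism of `R`; naturality against it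
        -- is compatibility with scalars.
        have := restrictedYoneda_app_comp α (P := .self R) (Q := .self R)
          (ModuleCat.homOfElement (M := ModuleCat.of R R) r) (ModuleCat.homOfElement m)
        refine (congrArg ModuleCat.evalOne this).trans ?_
        generalize α.app (.op (FGProjModule.self R)) (ModuleCat.homOfElement m) = k
        change (ModuleCat.of R R ⟶ N) at k
        change k.hom ((1 : R) • r) = r • k.hom (1 : R)
        rw [one_smul, ← map_smul, smul_eq_mul, mul_one] }

/-- The restricted Yoneda functor is fully faithful. -/
noncomputable def fullyFaithfulRestrictedYoneda (R : Type u) [Ring R] :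
    (restrictedYoneda R).FullyFaithful where
  preimage := restrictedYonedaPreimage
  map_preimage {M N} α := by
    ext ⟨P⟩ (h : P.obj ⟶ M)
    change h ≫ restrictedYonedaPreimage α = (α.app (.op P) h : P.obj ⟶ N)
    ext x
    -- Naturality along `R ⟶ P`, `1 ↦ x`, reduces the value of `α` at `P` to its value at `R`.
    have := restrictedYoneda_app_comp α (P := .self R) (ModuleCat.homOfElement x) h
    refine (congrArg (fun k : ModuleCat.of R R ⟶ M => ModuleCat.evalOne (M := N)
      (α.app (.op (FGProjModule.self R)) k)) (ModuleCat.homOfElement_comp x h).symm).trans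
      ((congrArg ModuleCat.evalOne this).trans ?_)
    exact congrArg (α.app (.op P) h : P.obj ⟶ N).hom (one_smul R x)
  preimage_map {M N} f := by
    ext m
    exact congrArg f.hom (one_smul R m)

instance : (restrictedYoneda R).Full := (fullyFaithfulRestrictedYoneda R).full
instance : (restrictedYoneda R).Faithful := (fullyFaithfulRestrictedYoneda R).faithful

/-- A splitting consists of equations between maps, which `Hom(-, M)` preserves for any module `M`,
projective or not. -/
lemma isLeftExact_restrictedYoneda (M : ModuleCat.{u} R) :
    (ExactStructure.split (FGProjModule R)).isLeftExact ((restrictedYoneda R).obj M) := by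
  rintro S ⟨s⟩
  have hs := congrArg (·.hom) s.s_g
  have hid := congrArg (·.hom) s.id
  have w := congrArg (·.hom) S.zero
  dsimp at hs hid w
  refine ⟨fun (a b : S.X₃.obj ⟶ M) hab => ?_, fun (a : S.X₂.obj ⟶ M) => ⟨fun ha => ?_, ?_⟩⟩
  · change S.g.hom ≫ a = S.g.hom ≫ b at hab
    have := congrArg (s.s.hom ≫ ·) hab
    simp only [reassoc_of% hs] at this
    exact this
  · change S.f.hom ≫ a = 0 at ha
    refine ⟨(s.s.hom ≫ a : S.X₃.obj ⟶ M), ?_⟩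
    change S.g.hom ≫ s.s.hom ≫ a = a
    have : (s.r.hom ≫ S.f.hom + S.g.hom ≫ s.s.hom) ≫ a = a := by
      refine (congrArg (· ≫ a) hid).trans (Category.id_comp a)
    simpa [ha] using this
  · rintro ⟨b, rfl⟩
    exact ((reassoc_of% w) (show S.X₃.obj ⟶ M from b)).trans zero_comp

end RestrictedYoneda

/-! ### Direct sums of finitely generated projective modules -/

namespace FGProjModule

open scoped Classical

variable {R : Type u} [Ring R] {J : Type u} (X : J → FGProjModule R)

/-- The direct sum of a family of finitely generated projective modules. -/
abbrev directSum : ModuleCat.{u} R := ModuleCat.of R (Π₀ j, (X j).obj)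

instance (P : FGProjModule R) : Module.Finite R P.obj := P.property.1

instance (P : FGProjModule R) : Module.Projective R P.obj := P.property.2

/-- The inclusion of a summand. -/
noncomputable def directSumι (j : J) : (X j).obj ⟶ directSum X :=
  ModuleCat.ofHom (DFinsupp.lsingle (M := fun j => (X j).obj) j)

/-- The projection to a summand. -/
noncomputable def directSumπ (j : J) : directSum X ⟶ (X j).obj :=
  ModuleCat.ofHom (DFinsupp.lapply (M := fun j => (X j).obj) j)

lemma directSumι_π_self (j : J) : directSumι X j ≫ directSumπ X j = 𝟙 _ := by
  ext x
  simp [directSumι, directSumπ]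

lemma directSumι_π_of_ne {i j : J} (h : i ≠ j) : directSumι X i ≫ directSumπ X j = 0 := by
  ext x
  simp [directSumι, directSumπ, DFinsupp.single_eq_of_ne h.symm]

/-- A morphism from a finitely generated module to a direct sum has finitely many nonzero
components. -/
lemma finite_support_comp_directSumπ {P : ModuleCat.{u} R} [Module.Finite R P]
    (h : P ⟶ directSum X) : {j | h ≫ directSumπ X j ≠ 0}.Finite := by
  obtain ⟨T, hT⟩ := Module.Finite.fg_top (R := R) (M := P)
  -- A component that kills every generator is zero, so the supports of the images of the generators
  -- contain all relevant indices.
  refine (T.biUnion fun t => (h t).support).finite_toSet.subset fun j hj => ?_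
  by_contra hjT
  refine hj (ModuleCat.hom_ext (LinearMap.ext_on hT fun t ht => ?_))
  by_contra hne
  refine hjT ?_
  simp only [Finset.coe_biUnion, Set.mem_iUnion]
  exact ⟨t, ht, by simpa [directSumπ] using hne⟩

/-- A morphism to a direct sum with components vanishing outside `S` is the sum over `S` of its
components. -/
lemma eq_sum_comp_directSumπ_ι {P : ModuleCat.{u} R} (h : P ⟶ directSum X) (S : Finset J)
    (hS : ∀ j ∉ S, h ≫ directSumπ X j = 0) :
    h = ∑ j ∈ S, (h ≫ directSumπ X j) ≫ directSumι X j := by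
  ext x i
  have hi (hi : i ∉ S) : h x i = 0 := congrArg (fun k => k.hom x) (hS i hi)
  rw [ModuleCat.hom_sum, LinearMap.sum_apply, DFinsupp.finsetSum_apply]
  simp only [directSumι, directSumπ, ModuleCat.hom_comp, ModuleCat.hom_ofHom,
    LinearMap.comp_apply, DFinsupp.lsingle_apply, DFinsupp.lapply_apply]
  rw [Finset.sum_eq_single i (fun j _ hj => by rw [DFinsupp.single_apply, dif_neg hj])
    (fun hiS => by rw [DFinsupp.single_apply, dif_pos rfl]; exact hi hiS),
    DFinsupp.single_apply, dif_pos rfl]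

/-! ### The presheaf of a direct sum as a coproduct of representables -/

/-- The transformation of presheaves induced by a morphism from a finitely generated projective
module. -/
noncomputable def yonedaToRestricted {P : FGProjModule R} {M : ModuleCat.{u} R} (f : P.obj ⟶ M) :
    preadditiveYoneda.obj P ⟶ (restrictedYoneda R).obj M where
  app Q := AddCommGrpCat.ofHom
    { toFun h := ((isFGProjModule R).ι.map (show Q.unop ⟶ P from h) ≫ f : Q.unop.obj ⟶ M)
      map_zero' := zero_comp
      map_add' _ _ := Preadditive.add_comp _ _ _ _ _ _ }
  naturality _ _ q := by
    refine AddCommGrpCat.ext fun h => ?_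
    exact Category.assoc q.unop.hom ((isFGProjModule R).ι.map (show _ ⟶ P from h)) f

/-- The transformation of presheaves induced by a morphism to a finitely generated projective
module. -/
noncomputable def restrictedToYoneda {P : FGProjModule R} {M : ModuleCat.{u} R} (f : M ⟶ P.obj) :
    (restrictedYoneda R).obj M ⟶ preadditiveYoneda.obj P where
  app Q := AddCommGrpCat.ofHom
    { toFun h := (ObjectProperty.homMk ((show Q.unop.obj ⟶ M from h) ≫ f) : Q.unop ⟶ P)
      map_zero' := ObjectProperty.hom_ext _ zero_comp
      map_add' _ _ := ObjectProperty.hom_ext _ (Preadditive.add_comp _ _ _ _ _ _) }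
  naturality _ _ q := by
    ext h
    exact ObjectProperty.hom_ext _ (Category.assoc _ _ _)

lemma yonedaToRestricted_toYoneda {P Q : FGProjModule R} {M : ModuleCat.{u} R} (f : P.obj ⟶ M)
    (g : M ⟶ Q.obj) : yonedaToRestricted f ≫ restrictedToYoneda g =
      preadditiveYoneda.map (ObjectProperty.homMk (f ≫ g)) := by
  ext T h
  exact ObjectProperty.hom_ext _ (Category.assoc _ _ _)

variable {F : (FGProjModule R)ᵒᵖ ⥤ AddCommGrpCat.{u}}

/-- Since `finsum` defaults to zero on infinite supports, this finiteness is what makes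
`directSumDesc` additive and natural. -/
lemma finite_support_app_directSumπ (f : ∀ j, preadditiveYoneda.obj (X j) ⟶ F)
    (P : (FGProjModule R)ᵒᵖ) (h : ((restrictedYoneda R).obj (directSum X)).obj P) :
    (Function.support fun j => (restrictedToYoneda (directSumπ X j) ≫ f j).app P h).Finite := by
  refine (finite_support_comp_directSumπ X (P := P.unop.obj) h).subset fun j hj hz => hj ?_
  have : (restrictedToYoneda (directSumπ X j)).app P h = 0 := ObjectProperty.hom_ext _ hz
  simp [this]

/-- The transformation out of the presheaf of a direct sum given by transformations out of the
representable presheaves of the summands. -/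
noncomputable def directSumDesc (f : ∀ j, preadditiveYoneda.obj (X j) ⟶ F) :
    (restrictedYoneda R).obj (directSum X) ⟶ F where
  app P := AddCommGrpCat.ofHom
    { toFun h := ∑ᶠ j, (restrictedToYoneda (directSumπ X j) ≫ f j).app P h
      map_zero' := finsum_eq_zero_of_forall_eq_zero fun j => map_zero _
      map_add' a b := (finsum_congr fun j => map_add _ a b).trans
        (finsum_add_distrib (finite_support_app_directSumπ X f P a)
          (finite_support_app_directSumπ X f P b)) }
  naturality P Q q := by
    ext h
    refine Eq.trans (finsum_congr fun j => ?_)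
      (AddMonoidHom.map_finsum (F.map q).hom (finite_support_app_directSumπ X f P h)).symm
    exact congrArg (fun φ => φ.hom h)
      ((restrictedToYoneda (directSumπ X j) ≫ f j).naturality q)

/-- Including the `j`-th summand and projecting to the `i`-th gives zero unless `i = j`, so one term
of the sum survives. -/
lemma yonedaToRestricted_directSumDesc (f : ∀ j, preadditiveYoneda.obj (X j) ⟶ F) (j : J) :
    yonedaToRestricted (directSumι X j) ≫ directSumDesc X f = f j := by
  ext P h
  refine (finsum_eq_single _ j fun i hi => ?_).trans ?_
  · change (yonedaToRestricted (directSumι X j) ≫ restrictedToYoneda (directSumπ X i) ≫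
      f i).app P h = 0
    rw [← Category.assoc, yonedaToRestricted_toYoneda, directSumι_π_of_ne X hi.symm]
    have hz : (preadditiveYoneda.map (ObjectProperty.homMk 0 : X j ⟶ X i)).app P h = 0 :=
      ObjectProperty.hom_ext _ comp_zero
    exact (congrArg ((f i).app P).hom hz).trans (map_zero _)
  · change (yonedaToRestricted (directSumι X j) ≫ restrictedToYoneda (directSumπ X j) ≫
      f j).app P h = _
    rw [← Category.assoc, yonedaToRestricted_toYoneda, directSumι_π_self X]
    exact congrArg ((f j).app P).hom (Category.comp_id (show P.unop ⟶ X j from h))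

/-- Each section `P ⟶ ⨁ X j` is a finite sum of sections that factor through single summands, and
transformations are additive. -/
lemma directSum_hom_ext {a b : (restrictedYoneda R).obj (directSum X) ⟶ F}
    (h : ∀ j, yonedaToRestricted (directSumι X j) ≫ a = yonedaToRestricted (directSumι X j) ≫ b) :
    a = b := by
  ext ⟨P⟩ (k : P.obj ⟶ directSum X)
  obtain ⟨S, hS⟩ := (finite_support_comp_directSumπ X k).exists_finset
  have hk := eq_sum_comp_directSumπ_ι X k S fun j hj => by simpa [hS] using hj
  have hsum (c : (restrictedYoneda R).obj (directSum X) ⟶ F) : c.app (.op P) k =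
      ∑ j ∈ S, c.app (.op P) ((k ≫ directSumπ X j) ≫ directSumι X j : P.obj ⟶ directSum X) :=
    (congrArg (fun l : P.obj ⟶ directSum X => c.app (.op P) l) hk).trans
      (map_sum (c.app (.op P)).hom _ _)
  refine (hsum a).trans (Eq.trans (Finset.sum_congr rfl fun j _ => ?_) (hsum b).symm)
  exact congrArg (fun φ => φ.app (.op P)
    (ObjectProperty.homMk (k ≫ directSumπ X j) : P ⟶ X j)) (h j)

end FGProjModule

/-! ### Direct sums as admissible Ind-objects -/

namespace FGProjModule

open scoped Classical

variable {R : Type u} [Ring R] {J : Type u} (X : J → FGProjModule R)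

lemma map_yonedaToRestricted {P Q : FGProjModule R} {M : ModuleCat.{u} R} (f : P ⟶ Q)
    (g : Q.obj ⟶ M) :
    preadditiveYoneda.map f ≫ yonedaToRestricted g = yonedaToRestricted (f.hom ≫ g) := by
  refine NatTrans.ext (funext fun T => AddCommGrpCat.ext fun h => ?_)
  exact Category.assoc ((isFGProjModule R).ι.map (show T.unop ⟶ P from h)) f.hom g

/-- The submodule of a direct sum of the elements supported in a finite set. -/
noncomputable def partialSum (S : Finset J) : Submodule R (Π₀ j, (X j).obj) :=
  LinearMap.range (DFinsupp.lmk (R := R) (M := fun j => (X j).obj) S)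

lemma mem_partialSum {S : Finset J} {x : Π₀ j, (X j).obj} :
    x ∈ partialSum X S ↔ ∀ j ∉ S, x j = 0 := by
  refine ⟨?_, fun h => ⟨fun j => x j, ?_⟩⟩
  · rintro ⟨y, rfl⟩ j hj
    exact DFinsupp.mk_of_notMem (β := fun j => (X j).obj) hj
  · ext j
    change DFinsupp.mk (β := fun j => (X j).obj) S (fun j => x j) j = x j
    by_cases hj : j ∈ S
    · exact DFinsupp.mk_of_mem (β := fun j => (X j).obj) hj
    · exact (DFinsupp.mk_of_notMem (β := fun j => (X j).obj) hj).trans (h j hj).symm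

/-- The projection of a direct sum to the elements supported in a finite set. -/
noncomputable def partialSumProj (S : Finset J) : (Π₀ j, (X j).obj) →ₗ[R] partialSum X S :=
  (DFinsupp.filterLinearMap R (fun j => (X j).obj) (· ∈ S)).codRestrict _ fun x =>
    (mem_partialSum X).2 fun _ hj => DFinsupp.filter_apply_neg x hj

lemma partialSumProj_apply (S : Finset J) (x : Π₀ j, (X j).obj) (j : J) :
    (partialSumProj X S x).1 j = if j ∈ S then x j else 0 :=
  DFinsupp.filter_apply _ _ _

lemma partialSumProj_coe {S : Finset J} (x : partialSum X S) : partialSumProj X S x = x := by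
  refine Subtype.ext (DFinsupp.ext fun j => ?_)
  rw [partialSumProj_apply]
  split_ifs with hj
  · rfl
  · exact ((mem_partialSum X).1 x.2 j hj).symm

lemma partialSum_mono {S T : Finset J} (h : S ≤ T) : partialSum X S ≤ partialSum X T :=
  fun _ hx => (mem_partialSum X).2 fun j hj => (mem_partialSum X).1 hx j fun hS => hj (h hS)

/-- The direct sum over a finite set, as a finitely generated projective module. -/
noncomputable def partialSumObj (S : Finset J) : FGProjModule R :=
  ⟨ModuleCat.of R (partialSum X S),
    inferInstanceAs (Module.Finite R
      (LinearMap.range (DFinsupp.lmk (R := R) (M := fun j => (X j).obj) S))),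
    Module.Projective.of_split (partialSum X S).subtype (partialSumProj X S)
      (LinearMap.ext fun x => partialSumProj_coe X x)⟩

/-- The inclusion of a finite partial sum into the direct sum. -/
noncomputable def partialSumι (S : Finset J) : (partialSumObj X S).obj ⟶ directSum X :=
  ModuleCat.ofHom (partialSum X S).subtype

/-- The projection of the direct sum to a finite partial sum. -/
noncomputable def partialSumπ (S : Finset J) : directSum X ⟶ (partialSumObj X S).obj :=
  ModuleCat.ofHom (partialSumProj X S)

instance (S : Finset J) : Mono (partialSumι X S) :=
  (ModuleCat.mono_iff_injective _).2 Subtype.val_injective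

lemma partialSumι_π (S : Finset J) : partialSumι X S ≫ partialSumπ X S = 𝟙 _ :=
  ModuleCat.hom_ext (LinearMap.ext fun x => partialSumProj_coe X x)

lemma directSumι_partialSumπ_ι {j : J} {S : Finset J} (hj : j ∈ S) :
    directSumι X j ≫ partialSumπ X S ≫ partialSumι X S = directSumι X j := by
  exact ModuleCat.hom_ext (LinearMap.ext fun x =>
    DFinsupp.filter_single_pos (β := fun j => (X j).obj) j x hj)

lemma directSumι_partialSumπ_of_notMem {j : J} {S : Finset J} (hj : j ∉ S) :
    directSumι X j ≫ partialSumπ X S = 0 := by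
  refine ModuleCat.hom_ext (LinearMap.ext fun x => Subtype.ext ?_)
  exact DFinsupp.filter_single_neg (β := fun j => (X j).obj) j x hj

/-- The directed diagram of the finite partial sums. -/
noncomputable def partialSumDiagram : Finset J ⥤ FGProjModule R where
  obj := partialSumObj X
  map a := ObjectProperty.homMk
    (ModuleCat.ofHom (Submodule.inclusion (partialSum_mono X (leOfHom a))))

/-- The partial sum over `T \ S` complements the one over `S` inside the one over `T`. -/
lemma isAdmissibleIndDiagram_partialSumDiagram :
    (ExactStructure.split (FGProjModule R)).IsAdmissibleIndDiagram (partialSumDiagram X) := by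
  refine ⟨inferInstance, inferInstance, fun S T a => ?_⟩
  have hST : S ⊆ T := leOfHom a
  refine ⟨partialSumObj X (T \ S), ObjectProperty.homMk (partialSumι X T ≫ partialSumπ X (T \ S)),
    ?_, ⟨{ r := ObjectProperty.homMk (partialSumι X T ≫ partialSumπ X S)
           s := (partialSumDiagram X).map (homOfLE Finset.sdiff_subset)
           f_r := ?_
           s_g := ?_
           id := ?_ }⟩⟩
  · refine ObjectProperty.hom_ext _ (ModuleCat.hom_ext (LinearMap.ext fun x => Subtype.ext
      (DFinsupp.ext fun j => ?_)))
    refine (partialSumProj_apply X _ _ j).trans ?_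
    split_ifs with hj
    · exact (mem_partialSum X).1 x.2 j (Finset.mem_sdiff.1 hj).2
    · rfl
  · exact ObjectProperty.hom_ext _ (partialSumι_π X S)
  · exact ObjectProperty.hom_ext _ (partialSumι_π X (T \ S))
  · refine ObjectProperty.hom_ext _ (ModuleCat.hom_ext (LinearMap.ext fun x => Subtype.ext
      (DFinsupp.ext fun j => ?_)))
    change (partialSumProj X S x.1).1 j + (partialSumProj X (T \ S) x.1).1 j = x.1 j
    have hx := (mem_partialSum X).1 x.2 j
    rw [partialSumProj_apply, partialSumProj_apply]
    by_cases hS : j ∈ S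
    · simp [hS]
    · by_cases hT : j ∈ T
      · simp [hS, hT]
      · simp [hS, hT, hx hT]

variable {F : (FGProjModule R)ᵒᵖ ⥤ AddCommGrpCat.{u}}

/-- The inclusion of a summand into a finite partial sum; it is zero if the index does not occur. -/
noncomputable def summandToPartialSum (j : J) (S : Finset J) : X j ⟶ partialSumObj X S :=
  ObjectProperty.homMk (directSumι X j ≫ partialSumπ X S)

/-- Membership in `S` matters: for `j ∉ S` the left side is zero, while the right side need not be.
-/
lemma summandToPartialSum_map {j : J} {S T : Finset J} (hj : j ∈ S) (a : S ⟶ T) :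
    summandToPartialSum X j S ≫ (partialSumDiagram X).map a = summandToPartialSum X j T := by
  refine ObjectProperty.hom_ext _ ((cancel_mono (partialSumι X T)).1 ?_)
  have h1 := directSumι_partialSumπ_ι X hj
  have h2 := directSumι_partialSumπ_ι X (leOfHom a hj)
  change (directSumι X j ≫ partialSumπ X S) ≫ partialSumι X S =
    (directSumι X j ≫ partialSumπ X T) ≫ partialSumι X T
  rw [Category.assoc, Category.assoc, h1, h2]

lemma map_summandToPartialSum_yonedaToRestricted {j : J} {S : Finset J} (hj : j ∈ S) :
    preadditiveYoneda.map (summandToPartialSum X j S) ≫ yonedaToRestricted (partialSumι X S) =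
      yonedaToRestricted (directSumι X j) := by
  rw [map_yonedaToRestricted]
  exact congrArg _ ((Category.assoc _ _ _).trans (directSumι_partialSumπ_ι X hj))

lemma yoneda_partialSum_hom_ext {S : Finset J} {a b : preadditiveYoneda.obj (partialSumObj X S) ⟶ F}
    (h : ∀ j ∈ S, preadditiveYoneda.map (summandToPartialSum X j S) ≫ a =
      preadditiveYoneda.map (summandToPartialSum X j S) ≫ b) : a = b := by
  -- The partial sum is a retract of the whole direct sum, so `directSum_hom_ext` applies; summands
  -- outside `S` contribute zero.
  have key (c : preadditiveYoneda.obj (partialSumObj X S) ⟶ F) :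
      c = yonedaToRestricted (partialSumι X S) ≫ restrictedToYoneda (partialSumπ X S) ≫ c := by
    have h1 : (ObjectProperty.homMk (𝟙 _) : partialSumObj X S ⟶ partialSumObj X S) = 𝟙 _ := rfl
    rw [← Category.assoc, yonedaToRestricted_toYoneda, partialSumι_π, h1, CategoryTheory.Functor.map_id,
      Category.id_comp]
  rw [key a, key b]
  congr 1
  refine directSum_hom_ext X fun j => ?_
  rw [← Category.assoc, ← Category.assoc, yonedaToRestricted_toYoneda]
  by_cases hj : j ∈ S
  · exact h j hj
  · rw [directSumι_partialSumπ_of_notMem X hj]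
    have : preadditiveYoneda.map (ObjectProperty.homMk 0 : X j ⟶ partialSumObj X S) = 0 := by
      refine NatTrans.ext (funext fun T => AddCommGrpCat.ext fun k => ?_)
      exact comp_zero (f := show T.unop ⟶ X j from k)
    rw [this, zero_comp, zero_comp]

/-- The presheaf of a direct sum, as a cocone over the finite partial sums. -/
noncomputable def partialSumCocone : Cocone (partialSumDiagram X ⋙ preadditiveYoneda) where
  pt := (restrictedYoneda R).obj (directSum X)
  ι :=
    { app S := yonedaToRestricted (partialSumι X S)
      naturality _ _ _ :=
        (map_yonedaToRestricted _ _).trans (Category.comp_id _).symm }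

/-- A compatible family on the finite partial sums is determined by its members at singletons, and
these glue by the coproduct property. -/
lemma partialSumι_directSumDesc (t : ∀ S, preadditiveYoneda.obj (partialSumObj X S) ⟶ F)
    (ht : ∀ ⦃S T : Finset J⦄ (a : S ⟶ T),
      preadditiveYoneda.map ((partialSumDiagram X).map a) ≫ t T = t S) (S : Finset J) :
    yonedaToRestricted (partialSumι X S) ≫ directSumDesc X (fun j =>
      preadditiveYoneda.map (summandToPartialSum X j {j}) ≫ t {j}) = t S := by
  refine yoneda_partialSum_hom_ext X fun j hj => ?_
  let a : ({j} : Finset J) ⟶ S := homOfLE (Finset.singleton_subset_iff.2 hj)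
  rw [← Category.assoc, map_summandToPartialSum_yonedaToRestricted X hj,
    yonedaToRestricted_directSumDesc, ← ht a]
  refine (Category.assoc _ _ _).symm.trans (congrArg (· ≫ t S) ?_)
  exact (preadditiveYoneda.map_comp _ _).symm.trans
    (congrArg _ (summandToPartialSum_map X (Finset.mem_singleton_self j) a))

lemma directSum_hom_ext_partialSum {a b : (restrictedYoneda R).obj (directSum X) ⟶ F}
    (h : ∀ S, yonedaToRestricted (partialSumι X S) ≫ a = yonedaToRestricted (partialSumι X S) ≫ b) :
    a = b := by
  refine directSum_hom_ext X fun j => ?_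
  rw [← map_summandToPartialSum_yonedaToRestricted X (Finset.mem_singleton_self j),
    Category.assoc, Category.assoc, h]

/-- The presheaf of a direct sum is the colimit of the finite partial sums. -/
noncomputable def isColimitPartialSumCocone : IsColimit (partialSumCocone X) where
  desc s := directSumDesc X fun j =>
    preadditiveYoneda.map (summandToPartialSum X j {j}) ≫ s.ι.app {j}
  fac s S := partialSumι_directSumDesc X s.ι.app (fun _ _ a => s.w a) S
  uniq s _ hm := directSum_hom_ext_partialSum X fun S =>
    (hm S).trans (partialSumι_directSumDesc X s.ι.app (fun _ _ a => s.w a) S).symm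

/-- The presheaf of a direct sum of finitely generated projective modules, as an admissible
Ind-object. -/
noncomputable def directSumInd : (ExactStructure.split (FGProjModule R)).Ind :=
  ⟨⟨(restrictedYoneda R).obj (directSum X), isLeftExact_restrictedYoneda _⟩,
    Finset J, inferInstance, partialSumDiagram X, isAdmissibleIndDiagram_partialSumDiagram X,
    ⟨(isColimitPartialSumCocone X).coconePointUniqueUpToIso (colimit.isColimit _)⟩⟩

/-! ### Coproducts in the idempotent completion -/

/-- The summands of a direct sum, as a cofan in the idempotent completion of the admissible
Ind-objects. -/
noncomputable def directSumCofan : Cofan fun j => (Idempotents.toKaroubi _).obj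
    ((ExactStructure.split (FGProjModule R)).toInd.obj (X j)) :=
  Cofan.mk ((Idempotents.toKaroubi _).obj (directSumInd X)) fun j =>
    (Idempotents.toKaroubi _).map
      (ObjectProperty.homMk (ObjectProperty.homMk (yonedaToRestricted (directSumι X j))))

/-- The presheaf of a direct sum is the direct sum of the representable presheaves of the summands
in the idempotent completion of the admissible Ind-objects. -/
noncomputable def isColimitDirectSumCofan : IsColimit (directSumCofan X) :=
  Cofan.IsColimit.mk _
    (fun s =>
      { f := ObjectProperty.homMk (ObjectProperty.homMk
          (directSumDesc X fun j => (s.inj j).f.hom.hom))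
        -- A map into an object of the idempotent completion must absorb its idempotent; each leg of
        -- the cofan already does, and that suffices.
        comm := by
          refine ObjectProperty.hom_ext _ (ObjectProperty.hom_ext _ (directSum_hom_ext X fun j => ?_))
          have h1 := yonedaToRestricted_directSumDesc X (fun j => (s.inj j).f.hom.hom) j
          have h2 : (s.inj j).f.hom.hom ≫ s.pt.p.hom.hom = (s.inj j).f.hom.hom :=
            congrArg (fun φ => φ.hom.hom) (Idempotents.Karoubi.comp_p (s.inj j))
          have h3 : yonedaToRestricted (directSumι X j) ≫
              directSumDesc X (fun j => (s.inj j).f.hom.hom) ≫ s.pt.p.hom.hom =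
                (s.inj j).f.hom.hom :=
            (Category.assoc _ _ _).symm.trans ((congrArg (· ≫ s.pt.p.hom.hom) h1).trans h2)
          refine Eq.trans ?_ (h3.trans h1.symm)
          exact congrArg (yonedaToRestricted (directSumι X j) ≫ ·) (Category.id_comp _) })
    (fun s j => Idempotents.Karoubi.hom_ext _ _ (ObjectProperty.hom_ext _ (ObjectProperty.hom_ext _
      (yonedaToRestricted_directSumDesc X (fun j => (s.inj j).f.hom.hom) j))))
    (fun s m hm => Idempotents.Karoubi.hom_ext _ _ (ObjectProperty.hom_ext _
      (ObjectProperty.hom_ext _ (directSum_hom_ext X fun j => by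
        refine Eq.trans ?_
          (yonedaToRestricted_directSumDesc X (fun j => (s.inj j).f.hom.hom) j).symm
        exact congrArg (fun φ => φ.f.hom.hom) (hm j)))))

end FGProjModule

/-! ### The equivalence -/

namespace CategoryTheory

open Idempotents

/-- Two retracts of an object cut out by the same idempotent are isomorphic. -/
def Retract.isoOfIdempotentEq {C : Type*} [Category* C] {X Y Z : C} (h : Retract X Z)
    (k : Retract Y Z) (e : h.r ≫ h.i = k.r ≫ k.i) : X ≅ Y where
  hom := h.i ≫ k.r
  inv := k.i ≫ h.r
  hom_inv_id := by
    rw [Category.assoc, ← Category.assoc k.r, ← e]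
    simp
  inv_hom_id := by
    rw [Category.assoc, ← Category.assoc h.r, e]
    simp

/-- The extension of a fully faithful functor to idempotent completions is fully faithful. -/
def Functor.FullyFaithful.functorExtension {C D : Type*} [Category* C] [Category* D] {F : C ⥤ D}
    (hF : F.FullyFaithful) : ((functorExtension₂ C D).obj F).FullyFaithful where
  preimage {X Y} f :=
    { f := hF.preimage f.f
      comm := hF.map_injective (by
        rw [F.map_comp, F.map_comp]
        have h := hF.map_preimage (X := X.X) (Y := Y.X) f.f
        exact (congrArg (fun g => F.map X.p ≫ g ≫ F.map Y.p) h).trans (f.comm.trans h.symm)) }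
  map_preimage f := Karoubi.hom_ext _ _ (hF.map_preimage _)
  preimage_map f := Karoubi.hom_ext _ _ (hF.preimage_map _)

/-- Fully faithful functors with the same essential image have equivalent sources. -/
noncomputable def Functor.equivalenceOfEssImageEq {C D E : Type*} [Category* C] [Category* D]
    [Category* E] (F : C ⥤ E) (G : D ⥤ E) [F.Full] [F.Faithful] [G.Full] [G.Faithful]
    (h : F.essImage = G.essImage) : C ≌ D :=
  F.toEssImage.asEquivalence.trans
    ((ObjectProperty.fullSubcategoryCongr h).trans G.toEssImage.asEquivalence.symm)

end CategoryTheory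

section

open Idempotents

/-- A direct summand is a retract. -/
lemma IsDirectSummand.nonempty_retract {D : Type u} [Category.{v} D] [Preadditive D] {A S : D}
    (h : IsDirectSummand A S) : Nonempty (Retract A S) := by
  obtain ⟨B, b, -, ⟨e⟩⟩ := h
  exact ⟨{ i := b.inl ≫ e.hom, r := e.inv ≫ b.fst }⟩

/-- An object of the idempotent completion is a direct summand of the underlying object. -/
lemma CategoryTheory.Idempotents.Karoubi.isDirectSummand {D : Type u} [Category.{v} D]
    [Preadditive D] (A : Karoubi D) : IsDirectSummand A ((toKaroubi D).obj A.X) :=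
  ⟨A.complement, BinaryBiproduct.bicone _ _, ⟨BinaryBiproduct.isBilimit _ _⟩, ⟨A.decomposition⟩⟩

/-! ### Both categories inside the idempotent completion of presheaves -/

variable (R : Type u) [Ring R]

/-- The projective modules, as objects of the idempotent completion of presheaves on finitely
generated projective modules. -/
noncomputable def ProjModule.toKaroubiPresheaf :
    ProjModule R ⥤ Karoubi ((FGProjModule R)ᵒᵖ ⥤ AddCommGrpCat.{u}) :=
  (isProjModule R).ι ⋙ restrictedYoneda R ⋙ toKaroubi _

instance : (ProjModule.toKaroubiPresheaf R).Full :=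
  inferInstanceAs ((isProjModule R).ι ⋙ restrictedYoneda R ⋙ toKaroubi _).Full

instance : (ProjModule.toKaroubiPresheaf R).Faithful :=
  inferInstanceAs ((isProjModule R).ι ⋙ restrictedYoneda R ⋙ toKaroubi _).Faithful

/-- The idempotent completion of the admissible Ind-objects, as objects of the idempotent
completion of presheaves. -/
noncomputable def ExactStructure.karoubiIndToPresheaf {C : Type u} [Category.{v} C] [Preadditive C]
    [HasFiniteBiproducts C] (E : ExactStructure C) :
    Karoubi E.Ind ⥤ Karoubi (Cᵒᵖ ⥤ AddCommGrpCat.{v}) :=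
  (functorExtension₂ _ _).obj (E.isAdmissibleInd.ι ⋙ E.isLeftExact.ι)

/-- The idempotent completion of the admissible Ind-objects embeds fully faithfully. -/
noncomputable def ExactStructure.fullyFaithfulKaroubiIndToPresheaf {C : Type u} [Category.{v} C]
    [Preadditive C] [HasFiniteBiproducts C] (E : ExactStructure C) :
    E.karoubiIndToPresheaf.FullyFaithful :=
  (E.isAdmissibleInd.fullyFaithfulι.comp E.isLeftExact.fullyFaithfulι).functorExtension

variable (C : Type u) [Category.{v} C] [Preadditive C] [HasFiniteBiproducts C]

/-- The category `P(C)`, as objects of the idempotent completion of presheaves. -/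
noncomputable def ProjObject.toKaroubiPresheaf :
    ProjObject C ⥤ Karoubi (Cᵒᵖ ⥤ AddCommGrpCat.{v}) :=
  (isProjObject C).ι ⋙ (ExactStructure.split C).karoubiIndToPresheaf

instance : (ProjObject.toKaroubiPresheaf C).Full :=
  ((isProjObject C).fullyFaithfulι.comp
    (ExactStructure.split C).fullyFaithfulKaroubiIndToPresheaf).full

instance : (ProjObject.toKaroubiPresheaf C).Faithful :=
  ((isProjObject C).fullyFaithfulι.comp
    (ExactStructure.split C).fullyFaithfulKaroubiIndToPresheaf).faithful

variable {R}

lemma ModuleCat.projective_of_retract {M N : ModuleCat.{u} R} (h : Retract M N)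
    [Module.Projective R N] : Module.Projective R M :=
  Module.Projective.of_split h.i.hom h.r.hom (congrArg (·.hom) h.retract)

/-- An idempotent endomorphism of a module splits. -/
lemma ModuleCat.exists_retract_of_idempotent {N : ModuleCat.{u} R} (e : N ⟶ N) (he : e ≫ e = e) :
    ∃ (M : ModuleCat.{u} R) (h : Retract M N), h.r ≫ h.i = e := by
  obtain ⟨M, i, r, h1, h2⟩ := IsIdempotentComplete.idempotents_split N e he
  exact ⟨M, ⟨i, r, h1⟩, h2⟩

/-- Projectivity splits the canonical surjection onto `M` from the free module on its own elements.
-/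
lemma ModuleCat.exists_retract_directSum (M : ModuleCat.{u} R) [Module.Projective R M] :
    Nonempty (Retract M (FGProjModule.directSum fun _ : M => FGProjModule.self R)) := by
  classical
  obtain ⟨s, hs⟩ := Module.projective_def'.1 ‹Module.Projective R M›
  let e : (M →₀ R) ≃ₗ[R] Π₀ _ : M, R := finsuppLequivDFinsupp R
  refine ⟨{ i := ModuleCat.ofHom (e.toLinearMap ∘ₗ s)
            r := ModuleCat.ofHom (Finsupp.linearCombination R id ∘ₗ e.symm.toLinearMap)
            retract := ?_ }⟩
  ext m
  change Finsupp.linearCombination R id (e.symm (e (s m))) = m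
  rw [e.symm_apply_apply]
  exact LinearMap.congr_fun hs m

lemma essImage_toKaroubiPresheaf : (ProjModule.toKaroubiPresheaf R).essImage =
    (ProjObject.toKaroubiPresheaf (FGProjModule R)).essImage := by
  refine le_antisymm ?_ ?_
  · rintro _ ⟨⟨M, hM⟩, ⟨φ⟩⟩
    have : Module.Projective R M := hM
    obtain ⟨h⟩ := ModuleCat.exists_retract_directSum M
    let X : M → FGProjModule R := fun _ => .self R
    -- Rather than showing that the presheaf of `M` is itself an Ind-object, take the idempotent
    -- that `M` defines on the Ind-object of the free module.
    let A : Karoubi (ExactStructure.split (FGProjModule R)).Ind :=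
      { X := FGProjModule.directSumInd X
        p := ObjectProperty.homMk (ObjectProperty.homMk ((restrictedYoneda R).map (h.r ≫ h.i)))
        idem := ObjectProperty.hom_ext _ (ObjectProperty.hom_ext _
          (((restrictedYoneda R).map_comp _ _).symm.trans (congrArg _ (by simp)))) }
    have hA : isProjObject (FGProjModule R) A :=
      ⟨M, X, FGProjModule.directSumCofan X, ⟨FGProjModule.isColimitDirectSumCofan X⟩,
        A.isDirectSummand⟩
    refine ⟨⟨A, hA⟩, ⟨Iso.trans ?_ φ⟩⟩
    refine Retract.isoOfIdempotentEq
      (A.retract.map (ExactStructure.split (FGProjModule R)).karoubiIndToPresheaf)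
      (h.map (restrictedYoneda R ⋙ toKaroubi _)) ?_
    refine Karoubi.hom_ext _ _ ((congrArg (fun φ => φ.hom.hom) A.idem).trans ?_)
    exact (restrictedYoneda R).map_comp _ _
  · rintro _ ⟨⟨A, J, X, c, ⟨hc⟩, hA⟩, ⟨φ⟩⟩
    obtain ⟨k⟩ := hA.nonempty_retract
    let Θ := (ExactStructure.split (FGProjModule R)).karoubiIndToPresheaf
    -- Uniqueness of coproducts replaces the abstract one by the presheaf of an actual direct sum of
    -- modules.
    let e := hc.coconePointUniqueUpToIso (FGProjModule.isColimitDirectSumCofan X)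
    let k' : Retract (Θ.obj A)
      ((restrictedYoneda R ⋙ toKaroubi _).obj (FGProjModule.directSum X)) :=
      (k.trans (Retract.ofIso e)).map Θ
    -- Fullness lifts the idempotent to a module endomorphism, and faithfulness makes the lift
    -- idempotent.
    obtain ⟨f, hf⟩ := (restrictedYoneda R ⋙ toKaroubi _).map_surjective (k'.r ≫ k'.i)
    obtain ⟨M, h, rfl⟩ := ModuleCat.exists_retract_of_idempotent f
      ((restrictedYoneda R ⋙ toKaroubi _).map_injective (by rw [Functor.map_comp, hf]; simp))
    have : Module.Projective R (FGProjModule.directSum X) :=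
      inferInstanceAs (Module.Projective R (Π₀ j, (X j).obj))
    refine ⟨⟨M, ModuleCat.projective_of_retract h⟩, ⟨Iso.trans ?_ φ⟩⟩
    exact Retract.isoOfIdempotentEq (h.map (restrictedYoneda R ⋙ toKaroubi _)) k'
      ((Functor.map_comp _ _ _).symm.trans hf)

end

theorem corollary3p27 (R : Type u) [Ring R] :
    Nonempty (ProjModule R ≌ ProjObject (FGProjModule R)) :=
  ⟨Functor.equivalenceOfEssImageEq _ _ essImage_toKaroubiPresheaf⟩
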